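/- Let $K=\mathbb{R}$ or $K=\mathbb{C}$ and let $d\ge 1$. Put $J=\begin{bmatrix}0&I_d\\-I_d&0\end{bmatrix}$, call $H\in K^{2d\times 2d}$ symplectic if $H^{T}JH=J$, and call a symplectic matrix $H$ singular if $\det(H-I)=0$. A unit triangular symplectic matrix is a matrix of the form $\begin{bmatrix}I&S\\0&I\end{bmatrix}$ or $\begin{bmatrix}I&0\\S&I\end{bmatrix}$ with $S\in K^{d\times d}$ symmetric ($S^T=S$). Then the set of $2d\times 2d$ singular symplectic matrices over $K$ is \[ \left\{Q\begin{bmatrix}I&0\\ \begin{bmatrix}0&0\\0&S_{6}\end{bmatrix}&I\end{bmatrix}\begin{bmatrix}I&S_{5}\\0&I\end{bmatrix}\begin{bmatrix}I&0\\ \begin{bmatrix}0&0\\0&S_{4}\end{bmatrix}&I\end{bmatrix}\begin{bmatrix}I&S_{3}\\0&I\end{bmatrix}\begin{bmatrix}I&0\\ \begin{bmatrix}0&0\\0&S_{2}\end{bmatrix}&I\end{bmatrix}\begin{bmatrix}I&S_{1}\\0&I\end{bmatrix}Q^{-1}\right\}, \] where $S_1,S_3,S_5$ range over all symmetric matrices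 in $K^{d\times d}$, $S_2,S_4,S_6$ range over all symmetric matrices in $K^{(d-1)\times(d-1)}$ (so that each $\begin{bmatrix}0&0\\0&S_{2i}\end{bmatrix}$ is the $d\times d$ matrix with zero first row and column and lower right block $S_{2i}$; it is the zero matrix if $d=1$), and $Q$ ranges over all symplectic matrices in $K^{2d\times 2d}$. Moreover, every symplectic $Q\in K^{2d\times 2d}$ is a product of $5$ unit triangular symplectic matrices. -/

import Mathlib

open Matrix

namespace UnitTriangularSymplectic

/-- The block matrix `[I, S; 0, I]`. -/
def upper {d : ℕ} {K : Type*} [CommRing K] (S : Matrix (Fin d) (Fin d) K) :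
    Matrix (Fin d ⊕ Fin d) (Fin d ⊕ Fin d) K :=
  Matrix.fromBlocks 1 S 0 1

/-- The block matrix `[I, 0; S, I]`. -/
def lower {d : ℕ} {K : Type*} [CommRing K] (S : Matrix (Fin d) (Fin d) K) :
    Matrix (Fin d ⊕ Fin d) (Fin d ⊕ Fin d) K :=
  Matrix.fromBlocks 1 0 S 1

/-- The `d × d` matrix `diag(0, S)`, whose first row and first column vanish and whose lower
right `(d - 1) × (d - 1)` block is `S`. -/
def padZero {d : ℕ} {K : Type*} [CommRing K] (S : Matrix (Fin (d - 1)) (Fin (d - 1)) K) :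
    Matrix (Fin d) (Fin d) K :=
  Matrix.of fun i j =>
    if h : 0 < i.val ∧ 0 < j.val then
      S ⟨i.val - 1, by have := i.isLt; omega⟩ ⟨j.val - 1, by have := j.isLt; omega⟩
    else 0

/-- The set of unit triangular symplectic matrices of size `2d × 2d`. -/
def unitTriangular (d : ℕ) (K : Type*) [CommRing K] :
    Set (Matrix (Fin d ⊕ Fin d) (Fin d ⊕ Fin d) K) :=
  {H | ∃ S : Matrix (Fin d) (Fin d) K, S.IsSymm ∧ (H = upper S ∨ H = lower S)}

/-- The set of all products of `n` unit triangular symplectic matrices. -/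
def unitTriangularProducts (d : ℕ) (K : Type*) [CommRing K] (n : ℕ) :
    Set (Matrix (Fin d ⊕ Fin d) (Fin d ⊕ Fin d) K) :=
  {H | ∃ l : List (Matrix (Fin d ⊕ Fin d) (Fin d ⊕ Fin d) K),
    l.length = n ∧ (∀ A ∈ l, A ∈ unitTriangular d K) ∧ H = l.prod}

/-- The set of singular symplectic matrices: the symplectic `H` with `det (H - I) = 0`. -/
def singularSymplectic (d : ℕ) (K : Type*) [CommRing K] :
    Set (Matrix (Fin d ⊕ Fin d) (Fin d ⊕ Fin d) K) :=
  {H | H ∈ Matrix.symplecticGroup (Fin d) K ∧ (H - 1).det = 0}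

end UnitTriangularSymplectic

/-!
A symplectic `H` is singular exactly when it fixes a nonzero vector. The symplectic group acts
transitively on nonzero vectors, so up to conjugation `H` fixes the first basis vector `e`, and it
remains to factor `H` so that the lower triangular factors fix `e` as well.

More generally, let `W` be a subspace of `K ^ d` such that `H` fixes `(w, 0)` for all `w ∈ W`.
Multiplying `H` by an upper factor makes its upper left block `G` invertible. The quotient of
`K ^ d` by `W` is a torsion `K[X]`-module through `G`, and a sum of cyclic modules `K[X] / (q)`
carries a symmetric nondegenerate form for which multiplication by `X` is self-adjoint. Pulled back
to `K ^ d`, this form is a symmetric matrix `Z` with kernel `W` such that `Z * G` is symmetric.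
Since `Z * G` and `G - 1` both vanish on `W`, there is a symmetric `S` with
`G - 1 = S * (Z * G)`, whence
`[G, *; C, *] = lower (C * G⁻¹ - Z) * upper S * lower (Z * G) * upper *`, and both lower
factors act trivially on `W`. The case `W = K e` treats singular matrices, and `W = 0` all
symplectic matrices.
-/

namespace UnitTriangularSymplectic

section InvariantForm

open Polynomial

/-- An invariant form of an `R`-module over a base ring `K`: a symmetric separating `K`-bilinear
form for which every element of `R` acts as a self-adjoint map. It is used with `R = K[X]`, acting
through an endomorphism of a vector space. -/
structure IsInvariantForm (R : Type*) {K M : Type*} [CommRing K] [AddCommGroup M] [Module K M]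
    [SMul R M] (B : LinearMap.BilinForm K M) : Prop where
  isSymm : B.IsSymm
  separatingLeft : B.SeparatingLeft
  smul_left (r : R) (x y : M) : B (r • x) y = B x (r • y)

theorem IsInvariantForm.congr {K R M N : Type*} [CommRing K] [Ring R] [Algebra K R]
    [AddCommGroup M] [Module K M] [Module R M] [IsScalarTower K R M]
    [AddCommGroup N] [Module K N] [Module R N] [IsScalarTower K R N]
    (e : M ≃ₗ[R] N) {B : LinearMap.BilinForm K M} (hB : IsInvariantForm R B) :
    IsInvariantForm R (LinearMap.BilinForm.congr (e.restrictScalars K) B) where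
  isSymm := ⟨fun _ _ => hB.isSymm.eq _ _⟩
  separatingLeft x hx := by
    have hx' : e.symm x = 0 := hB.separatingLeft _ fun y => by simpa using hx (e y)
    simpa using hx'
  smul_left r x y := by simpa using hB.smul_left r (e.symm x) (e.symm y)

theorem IsInvariantForm.pi {ι K R : Type*} {M : ι → Type*} [Fintype ι] [CommRing K]
    [∀ i, AddCommGroup (M i)] [∀ i, Module K (M i)] [∀ i, SMul R (M i)]
    {B : ∀ i, LinearMap.BilinForm K (M i)} (hB : ∀ i, IsInvariantForm R (B i)) :
    IsInvariantForm R (∑ i, (B i).comp (LinearMap.proj i) (LinearMap.proj i)) where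
  isSymm := ⟨fun x y => by simp [fun i => (hB i).isSymm.eq (x i) (y i)]⟩
  separatingLeft x hx := by
    classical
    refine funext fun i => (hB i).separatingLeft _ fun y => ?_
    have h := hx (Pi.single i y)
    rw [LinearMap.sum_apply, LinearMap.sum_apply, Finset.sum_eq_single i] at h
    · simpa using h
    · intro j _ hj
      simp [Pi.single_eq_of_ne hj]
    · simp
  smul_left r x y := by simp [fun i => (hB i).smul_left r (x i) (y i)]

theorem exists_isInvariantForm_quotient_span_of_monic {K : Type*} [CommRing K] {q : K[X]}
    (hq : q.Monic) :
    ∃ B : LinearMap.BilinForm K (K[X] ⧸ Ideal.span {q}), IsInvariantForm K[X] B := by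
  let topCoeff : AdjoinRoot q →ₗ[K] K :=
    lcoeff K (q.natDegree - 1) ∘ₗ AdjoinRoot.modByMonicHom hq
  refine ⟨(LinearMap.mul K (AdjoinRoot q)).compr₂ topCoeff,
    ⟨fun x y => congrArg topCoeff (mul_comm x y)⟩, fun x hx => ?_, fun p x y => ?_⟩
  · obtain ⟨f, rfl⟩ := AdjoinRoot.mk_surjective x
    have hr : AdjoinRoot.mk q (f %ₘ q) = AdjoinRoot.mk q f :=
      AdjoinRoot.mk_leftInverse hq (AdjoinRoot.mk q f)
    cases subsingleton_or_nontrivial K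
    · exact (Module.subsingleton K (AdjoinRoot q)).elim _ _
    have hdeg := degree_modByMonic_lt f hq
    rw [← hr] at hx ⊢
    generalize f %ₘ q = r at *
    by_contra hne
    have hr0 : r ≠ 0 := by
      rintro rfl
      exact hne (map_zero _)
    have hlt : r.natDegree < q.natDegree := natDegree_lt_natDegree hr0 hdeg
    -- Multiplying `r` by `X ^ k` moves its leading coefficient to the degree read by `topCoeff`.
    set k := q.natDegree - 1 - r.natDegree
    have hdeg' : (r * X ^ k).natDegree = q.natDegree - 1 := by
      rw [natDegree_mul_X_pow _ hr0]
      omega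
    have htop : ((r * X ^ k) %ₘ q).coeff (q.natDegree - 1) = 0 := hx (AdjoinRoot.mk q (X ^ k))
    rw [(modByMonic_eq_self_iff hq).2 (degree_lt_degree (by omega)), ← hdeg', coeff_natDegree,
      leadingCoeff_mul_X_pow, leadingCoeff_eq_zero] at htop
    exact hr0 htop
  · obtain ⟨f, rfl⟩ := AdjoinRoot.mk_surjective x
    obtain ⟨g, rfl⟩ := AdjoinRoot.mk_surjective y
    change ((p * f * g) %ₘ q).coeff _ = ((f * (p * g)) %ₘ q).coeff _
    rw [mul_assoc, mul_left_comm]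

theorem exists_isInvariantForm_quotient_span {K : Type*} [Field K] {q : K[X]} (hq : q ≠ 0) :
    ∃ B : LinearMap.BilinForm K (K[X] ⧸ Ideal.span {q}), IsInvariantForm K[X] B := by
  classical
  rw [Ideal.span_singleton_eq_span_singleton.2 (associated_normalize q)]
  exact exists_isInvariantForm_quotient_span_of_monic (monic_normalize hq)

theorem exists_isInvariantForm_of_isTorsion {K M : Type*} [Field K] [AddCommGroup M] [Module K M]
    [Module K[X] M] [IsScalarTower K K[X] M] [Module.Finite K[X] M]
    (hM : Module.IsTorsion K[X] M) :
    ∃ B : LinearMap.BilinForm K M, IsInvariantForm K[X] B := by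
  obtain ⟨ι, _, p, hp, k, ⟨f⟩⟩ := Module.equiv_directSum_of_isTorsion hM
  choose B hB using fun i =>
    exists_isInvariantForm_quotient_span (pow_ne_zero (k i) (hp i).ne_zero)
  exact ⟨_, (IsInvariantForm.pi hB).congr
    (f.trans (DirectSum.linearEquivFunOnFintype K[X] ι _)).symm⟩

theorem exists_isSymm_isSelfAdjoint_ker_eq {K V : Type*} [Field K] [AddCommGroup V] [Module K V]
    [FiniteDimensional K V] (φ : Module.End K V) {W : Submodule K V} (hW : W ≤ W.comap φ) :
    ∃ B : LinearMap.BilinForm K V, B.IsSymm ∧ B.IsSelfAdjoint φ ∧ B.ker = W := by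
  let ψ : Module.End K (V ⧸ W) := W.mapQ W φ hW
  obtain ⟨B, hB⟩ := exists_isInvariantForm_of_isTorsion
    (Module.AEval.isTorsion_of_finiteDimensional K (V ⧸ W) ψ)
  let π : V →ₗ[K] Module.AEval' ψ := (Module.AEval'.of ψ).toLinearMap ∘ₗ W.mkQ
  have hπ : Function.Surjective π := (Module.AEval'.of ψ).surjective.comp W.mkQ_surjective
  have hπφ (x : V) : π (φ x) = (X : K[X]) • π x := (Module.AEval'.X_smul_of ψ (W.mkQ x)).symm
  refine ⟨B.comp π π, ⟨fun x y => hB.isSymm.eq _ _⟩, fun x y => ?_, ?_⟩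
  · simp only [LinearMap.BilinForm.comp_apply, hπφ, hB.smul_left]
  · ext x
    have hker : π x = 0 ↔ x ∈ W := by simp [π]
    rw [LinearMap.mem_ker, ← hker]
    refine ⟨fun hx => hB.separatingLeft _ fun y => ?_, fun hx => ?_⟩
    · obtain ⟨y, rfl⟩ := hπ y
      exact LinearMap.congr_fun hx y
    · ext y
      simp [hx]

end InvariantForm

section LinearAlgebra

variable {K m n : Type*} [Field K]

theorem exists_isCompl_span_image {ι V : Type*} [AddCommGroup V] [Module K V] {v : ι → V}
    (hv : Submodule.span K (Set.range v) = ⊤) (W : Submodule K V) :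
    ∃ I : Set ι, IsCompl W (Submodule.span K (v '' I)) := by
  obtain ⟨I, -, -, hspan, hI⟩ := exists_linearIndepOn_extension
    (linearIndepOn_empty K (W.mkQ ∘ v)) (Set.subset_univ ∅)
  refine ⟨I, ?_, ?_⟩
  · have hdisj := Submodule.range_ker_disjoint (v := I.domRestrict v) (f := W.mkQ) hI
    rwa [Set.range_domRestrict, W.ker_mkQ, disjoint_comm] at hdisj
  · rw [codisjoint_iff, ← Submodule.map_mkQ_eq_top, Submodule.map_span, ← Set.image_comp,
      eq_top_iff, ← W.range_mkQ, ← Submodule.map_top, ← hv, Submodule.map_span,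
      Submodule.span_le, ← Set.range_comp, ← Set.image_univ]
    exact hspan

theorem exists_mul_mul_eq_self [Fintype m] [Fintype n] (P : Matrix m n K) :
    ∃ R : Matrix n m K, P * R * P = P := by
  classical
  obtain ⟨g, hg⟩ := P.mulVecLin.rangeRestrict.exists_rightInverse_of_surjective
    P.mulVecLin.range_rangeRestrict
  obtain ⟨f, hf⟩ := g.exists_extend
  refine ⟨LinearMap.toMatrix' f, Matrix.toLin'.injective (LinearMap.ext fun v => ?_)⟩
  have hfg : f (P *ᵥ v) = g (P.mulVecLin.rangeRestrict v) :=
    LinearMap.congr_fun hf (P.mulVecLin.rangeRestrict v)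
  have hgP : P *ᵥ g (P.mulVecLin.rangeRestrict v) = P *ᵥ v :=
    congrArg Subtype.val (LinearMap.congr_fun hg (P.mulVecLin.rangeRestrict v))
  rw [toLin'_apply, ← mulVec_mulVec, ← mulVec_mulVec, LinearMap.toMatrix'_mulVec, hfg, hgP,
    toLin'_apply]

theorem exists_isSymm_mul_eq [Fintype m] [Fintype n] {P Q : Matrix m n K}
    (hPQ : (Pᵀ * Q).IsSymm) (hker : ∀ v, P *ᵥ v = 0 → Q *ᵥ v = 0) :
    ∃ S : Matrix m m K, S.IsSymm ∧ S * P = Q := by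
  classical
  obtain ⟨R, hR⟩ := exists_mul_mul_eq_self P
  have hQR : Q * R * P = Q := by
    refine ext_of_mulVec_single fun i => ?_
    have h := hker (R *ᵥ P *ᵥ Pi.single i 1 - Pi.single i 1) (by
      rw [mulVec_sub, mulVec_mulVec, mulVec_mulVec, hR, sub_self])
    rwa [mulVec_sub, sub_eq_zero, mulVec_mulVec, mulVec_mulVec] at h
  have hQP : Qᵀ * P = Pᵀ * Q := by simpa using hPQ.eq
  -- `Q * R` solves the equation; the correction terms make it symmetric and cancel on `P`.
  refine ⟨Q * R + (Q * R)ᵀ - Rᵀ * (Pᵀ * Q) * R, ?_, ?_⟩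
  · simp only [IsSymm, transpose_sub, transpose_add, transpose_transpose, transpose_mul, hQP,
      Matrix.mul_assoc, add_comm]
  · simp only [Matrix.mul_assoc] at hQR
    simp only [Matrix.sub_mul, Matrix.add_mul, Matrix.mul_assoc, transpose_mul, hQR, hQP,
      add_sub_cancel_right]

theorem exists_isSymm_mulVec_eq [Fintype n] {p : n → K} (hp : p ≠ 0) (q : n → K) :
    ∃ S : Matrix n n K, S.IsSymm ∧ S *ᵥ p = q := by
  obtain ⟨S, hS, hSp⟩ := exists_isSymm_mul_eq (P := replicateCol Unit p) (Q := replicateCol Unit q)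
    (IsSymm.ext fun _ _ => rfl) fun v hv => by
      obtain ⟨i, hi⟩ := Function.ne_iff.1 hp
      have hvi : p i * v () = 0 := by simpa [mulVec, dotProduct] using congrFun hv i
      ext j
      simp [mulVec, dotProduct, (mul_eq_zero.1 hvi).resolve_left hi]
  exact ⟨S, hS, replicateCol_injective (by rw [replicateCol_mulVec, hSp])⟩

theorem exists_isSymm_isUnit_det_add_mul [Fintype n] [DecidableEq n] {A C : Matrix n n K}
    (hAC : Aᵀ * C = Cᵀ * A) (hker : ∀ v, A *ᵥ v = 0 → C *ᵥ v = 0 → v = 0) :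
    ∃ X : Matrix n n K, X.IsSymm ∧ IsUnit (A + X * C).det := by
  classical
  obtain ⟨I, hI⟩ := exists_isCompl_span_image (Pi.basisFun K n).span_eq A.mulVecLin.range
  refine ⟨diagonal fun i => if i ∈ I then 1 else 0, isSymm_diagonal _, ?_⟩
  rw [isUnit_iff_ne_zero]
  intro hdet
  obtain ⟨v, hv, hv0⟩ := exists_mulVec_eq_zero_iff.2 hdet
  have hX : (diagonal fun i => if i ∈ I then (1 : K) else 0) *ᵥ C *ᵥ v =
      fun i => if i ∈ I then (C *ᵥ v) i else 0 := by
    ext i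
    simp [mulVec_diagonal]
  rw [add_mulVec, ← mulVec_mulVec, hX] at hv0
  have hspan (x : n → K) : x ∈ Submodule.span K (Pi.basisFun K n '' I) ↔ ∀ i ∉ I, x i = 0 := by
    rw [Module.Basis.mem_span_image]
    simp [Set.subset_def, not_imp_comm]
  have hA : A *ᵥ v = 0 := by
    refine Submodule.disjoint_def.1 hI.disjoint _ ⟨v, rfl⟩ ((hspan _).2 fun i hi => ?_)
    simpa [hi] using congrFun hv0 i
  have hCI (i : n) (hi : i ∈ I) : (C *ᵥ v) i = 0 := by
    simpa [hA, hi] using congrFun hv0 i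
  have hCA : Aᵀ *ᵥ C *ᵥ v = 0 := by
    rw [mulVec_mulVec, hAC, ← mulVec_mulVec, hA, mulVec_zero]
  refine hv (hker v hA (dotProduct_eq_zero _ fun u => ?_))
  obtain ⟨_, ⟨a, rfl⟩, s, hs, rfl⟩ :=
    Submodule.mem_sup.1 (hI.sup_eq_top.symm ▸ Submodule.mem_top (x := u))
  have hCa : C *ᵥ v ⬝ᵥ A *ᵥ a = 0 := by
    rw [dotProduct_mulVec, ← mulVec_transpose, hCA, zero_dotProduct]
  have hCs : C *ᵥ v ⬝ᵥ s = 0 := Finset.sum_eq_zero fun i _ => by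
    by_cases hi : i ∈ I
    · rw [hCI i hi, zero_mul]
    · rw [(hspan s).1 hs i hi, mul_zero]
  rw [dotProduct_add, mulVecLin_apply, hCa, hCs, add_zero]

theorem isSymm_mul_inv_of_transpose_mul_eq [Fintype n] [DecidableEq n] {G C : Matrix n n K}
    (hGC : Gᵀ * C = Cᵀ * G) (hG : IsUnit G.det) : (C * G⁻¹).IsSymm := by
  have hGT : IsUnit (Gᵀ).det := by rwa [det_transpose]
  calc (C * G⁻¹)ᵀ = Gᵀ⁻¹ * (Cᵀ * G) * G⁻¹ := by
        rw [transpose_mul, transpose_nonsing_inv, mul_assoc, mul_nonsing_inv_cancel_right _ _ hG]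
    _ = C * G⁻¹ := by rw [← hGC, nonsing_inv_mul_cancel_left _ _ hGT]

theorem exists_isSymm_isSymm_mul_mulVec_eq_zero_iff [Fintype n] {A : Matrix n n K}
    {W : Submodule K (n → K)} (hW : W ≤ W.comap A.mulVecLin) :
    ∃ Z : Matrix n n K, Z.IsSymm ∧ (Z * A).IsSymm ∧ ∀ v, Z *ᵥ v = 0 ↔ v ∈ W := by
  classical
  obtain ⟨B, hB, hBA, hker⟩ := exists_isSymm_isSelfAdjoint_ker_eq A.mulVecLin hW
  obtain ⟨Z, rfl⟩ := Matrix.toBilin'.surjective B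
  have hZ : Z.IsSymm := isSymm_toBilin'_iff_isSymm.1 hB
  refine ⟨Z, hZ, ?_, fun v => ?_⟩
  · have h : Aᵀ * Z = Z * A := (isAdjointPair_toLinearMap₂' Z Z A A).1 hBA
    rw [IsSymm, transpose_mul, hZ.eq, h]
  · rw [← hker, LinearMap.mem_ker, LinearMap.ext_iff, ← dotProduct_eq_zero_iff]
    refine forall_congr' fun x => ?_
    rw [toBilin'_apply', dotProduct_mulVec, ← mulVec_transpose, hZ.eq, LinearMap.zero_apply]

theorem exists_isSymm_mul_eq_sub_one [Fintype n] [DecidableEq n] {G : Matrix n n K}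
    (hG : IsUnit G.det) {W : Submodule K (n → K)} (hW : ∀ w ∈ W, G *ᵥ w = w) :
    ∃ Z S : Matrix n n K, Z.IsSymm ∧ (Z * G).IsSymm ∧ S.IsSymm ∧ (∀ w ∈ W, Z *ᵥ w = 0) ∧
      S * (Z * G) = G - 1 := by
  obtain ⟨Z, hZ, hZG, hker⟩ := exists_isSymm_isSymm_mul_mulVec_eq_zero_iff (A := G) (W := W)
    fun w hw => by simpa [hW w hw] using hw
  have hfix (v : n → K) (hv : (Z * G) *ᵥ v = 0) : (G - 1) *ᵥ v = 0 := by
    rw [← mulVec_mulVec, hker] at hv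
    have hinj := mulVec_injective_iff_isUnit.2 ((isUnit_iff_isUnit_det G).2 hG)
    rw [sub_mulVec, one_mulVec, hinj (hW _ hv), sub_self]
  have hsymm : ((Z * G)ᵀ * (G - 1)).IsSymm := by
    rw [hZG.eq, mul_sub, mul_one]
    refine IsSymm.sub ?_ hZG
    calc (Z * G * G)ᵀ = Gᵀ * (Z * G)ᵀ := transpose_mul _ _
      _ = Z * G * G := by
        rw [hZG.eq, ← mul_assoc]
        nth_rw 1 [← hZ.eq]
        rw [← transpose_mul, hZG.eq]
  obtain ⟨S, hS, hSG⟩ := exists_isSymm_mul_eq hsymm hfix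
  exact ⟨Z, S, hZ, hZG, hS, fun w hw => (hker w).2 hw, hSG⟩

end LinearAlgebra

section Symplectic

section CommRing

variable {K : Type*} [CommRing K]

theorem inv_mem_symplecticGroup {l : Type*} [Fintype l] [DecidableEq l]
    {A : Matrix (l ⊕ l) (l ⊕ l) K} (hA : A ∈ symplecticGroup l K) :
    A⁻¹ ∈ symplecticGroup l K := by
  simpa only [SymplecticGroup.coe_inv'] using (⟨A, hA⟩ : symplecticGroup l K)⁻¹.2

variable {d : ℕ}

theorem upper_mem_symplecticGroup {S : Matrix (Fin d) (Fin d) K} (hS : S.IsSymm) :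
    upper S ∈ symplecticGroup (Fin d) K :=
  SymplecticGroup.fromBlocks_mem_iff.2 (by simp [hS.eq])

theorem lower_mem_symplecticGroup {S : Matrix (Fin d) (Fin d) K} (hS : S.IsSymm) :
    lower S ∈ symplecticGroup (Fin d) K :=
  SymplecticGroup.fromBlocks_mem_iff.2 (by simp [hS.eq])

theorem upper_mulVec (S : Matrix (Fin d) (Fin d) K) (p q : Fin d → K) :
    upper S *ᵥ Sum.elim p q = Sum.elim (p + S *ᵥ q) q := by
  simp [upper, fromBlocks_mulVec]

theorem lower_mulVec (S : Matrix (Fin d) (Fin d) K) (p q : Fin d → K) :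
    lower S *ᵥ Sum.elim p q = Sum.elim p (S *ᵥ p + q) := by
  simp [lower, fromBlocks_mulVec]

theorem fromBlocks_mulVec_elim_zero (A B C D : Matrix (Fin d) (Fin d) K) (x : Fin d → K) :
    fromBlocks A B C D *ᵥ Sum.elim x 0 = Sum.elim (A *ᵥ x) (C *ᵥ x) := by
  simp [fromBlocks_mulVec]

theorem upper_mul_upper (S T : Matrix (Fin d) (Fin d) K) : upper S * upper T = upper (S + T) := by
  simp [upper, fromBlocks_multiply, add_comm]

theorem upper_zero : upper (0 : Matrix (Fin d) (Fin d) K) = 1 :=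
  fromBlocks_one

theorem lower_zero : lower (0 : Matrix (Fin d) (Fin d) K) = 1 :=
  fromBlocks_one

theorem exists_eq_upper_of_mulVec_eq_self {H : Matrix (Fin d ⊕ Fin d) (Fin d ⊕ Fin d) K}
    (hH : H ∈ symplecticGroup (Fin d) K)
    (hfix : ∀ x : Fin d → K, H *ᵥ Sum.elim x 0 = Sum.elim x 0) :
    ∃ S : Matrix (Fin d) (Fin d) K, S.IsSymm ∧ H = upper S := by
  obtain ⟨A, B, C, D, rfl⟩ : ∃ A B C D, H = fromBlocks A B C D :=
    ⟨_, _, _, _, (fromBlocks_toBlocks H).symm⟩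
  simp only [fromBlocks_mulVec_elim_zero, Sum.elim_eq_iff] at hfix
  obtain rfl : A = 1 := ext_of_mulVec_single fun i => by rw [(hfix _).1, one_mulVec]
  obtain rfl : C = 0 := ext_of_mulVec_single fun i => by rw [(hfix _).2, zero_mulVec]
  obtain ⟨-, hBD, hD⟩ := SymplecticGroup.fromBlocks_mem_iff.1 hH
  obtain rfl : D = 1 := by simpa using hD
  exact ⟨B, by simpa [IsSymm] using hBD, rfl⟩

theorem exists_eq_mul_upper_of_mulVec_eq {M N : Matrix (Fin d ⊕ Fin d) (Fin d ⊕ Fin d) K}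
    (hM : M ∈ symplecticGroup (Fin d) K) (hN : N ∈ symplecticGroup (Fin d) K)
    (hMN : ∀ x : Fin d → K, M *ᵥ Sum.elim x 0 = N *ᵥ Sum.elim x 0) :
    ∃ S : Matrix (Fin d) (Fin d) K, S.IsSymm ∧ M = N * upper S := by
  have hdet := SymplecticGroup.symplectic_det hN
  obtain ⟨S, hS, h⟩ := exists_eq_upper_of_mulVec_eq_self
    (mul_mem (inv_mem_symplecticGroup hN) hM) fun x => by
      rw [← mulVec_mulVec, hMN, mulVec_mulVec, nonsing_inv_mul _ hdet, one_mulVec]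
  exact ⟨S, hS, by rw [← h, mul_nonsing_inv_cancel_left _ _ hdet]⟩

end CommRing

section Field

variable {K : Type*} [Field K] {d : ℕ}

theorem exists_symplectic_mulVec_eq_elim_self {x : Fin d → K} (hx : x ≠ 0)
    {v : Fin d ⊕ Fin d → K} (hv : v ≠ 0) :
    ∃ Q ∈ symplecticGroup (Fin d) K, Q *ᵥ v = Sum.elim x x := by
  obtain ⟨p, q, rfl⟩ : ∃ p q, v = Sum.elim p q := ⟨_, _, (Sum.elim_comp_inl_inr v).symm⟩
  by_cases hq : q = 0
  · have hp : p ≠ 0 := by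
      rintro rfl
      exact hv (by simp [hq])
    obtain ⟨S, hS, hSp⟩ := exists_isSymm_mulVec_eq hp x
    obtain ⟨T, hT, hTx⟩ := exists_isSymm_mulVec_eq hx (x - p)
    refine ⟨upper T * lower S,
      mul_mem (upper_mem_symplecticGroup hT) (lower_mem_symplecticGroup hS), ?_⟩
    rw [← mulVec_mulVec, lower_mulVec, hq, add_zero, hSp, upper_mulVec, hTx, add_sub_cancel]
  · obtain ⟨S, hS, hSq⟩ := exists_isSymm_mulVec_eq hq (x - p)
    obtain ⟨T, hT, hTx⟩ := exists_isSymm_mulVec_eq hx (x - q)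
    refine ⟨lower T * upper S,
      mul_mem (lower_mem_symplecticGroup hT) (upper_mem_symplecticGroup hS), ?_⟩
    rw [← mulVec_mulVec, upper_mulVec, hSq, lower_mulVec, add_sub_cancel, hTx, sub_add_cancel]

theorem exists_symplectic_mulVec_eq {v w : Fin d ⊕ Fin d → K} (hv : v ≠ 0) (hw : w ≠ 0) :
    ∃ Q ∈ symplecticGroup (Fin d) K, Q *ᵥ v = w := by
  obtain ⟨i⟩ : Nonempty (Fin d) := by simpa using (Function.ne_iff.1 hv).nonempty
  have hx : (Pi.single i 1 : Fin d → K) ≠ 0 := by simp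
  obtain ⟨P, hP, hPv⟩ := exists_symplectic_mulVec_eq_elim_self hx hv
  obtain ⟨R, hR, hRw⟩ := exists_symplectic_mulVec_eq_elim_self hx hw
  refine ⟨R⁻¹ * P, mul_mem (inv_mem_symplecticGroup hR) hP, ?_⟩
  rw [← mulVec_mulVec, hPv, ← hRw, mulVec_mulVec,
    nonsing_inv_mul _ (SymplecticGroup.symplectic_det hR), one_mulVec]

theorem exists_isSymm_isUnit_det_add_mul_of_mem_symplecticGroup {A B C D : Matrix (Fin d) (Fin d) K}
    (hH : fromBlocks A B C D ∈ symplecticGroup (Fin d) K) :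
    ∃ X : Matrix (Fin d) (Fin d) K, X.IsSymm ∧ IsUnit (A + X * C).det := by
  refine exists_isSymm_isUnit_det_add_mul (SymplecticGroup.fromBlocks_mem_iff.1 hH).1
    fun v hA hC => ?_
  have hinj := mulVec_injective_of_isUnit
    ((isUnit_iff_isUnit_det _).2 (SymplecticGroup.symplectic_det hH))
  have hv : Sum.elim v 0 = 0 := hinj (by simp [fromBlocks_mulVec_elim_zero, hA, hC])
  exact funext fun i => congrFun hv (Sum.inl i)

theorem exists_eq_lower_mul_upper_mul_lower_mul_upper {G B C D : Matrix (Fin d) (Fin d) K}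
    (hH : fromBlocks G B C D ∈ symplecticGroup (Fin d) K) (hG : IsUnit G.det)
    {W : Submodule K (Fin d → K)} (hGW : ∀ w ∈ W, G *ᵥ w = w) (hCW : ∀ w ∈ W, C *ᵥ w = 0) :
    ∃ S₁ S₂ S₃ S₄ : Matrix (Fin d) (Fin d) K,
      S₁.IsSymm ∧ S₂.IsSymm ∧ S₃.IsSymm ∧ S₄.IsSymm ∧
      (∀ w ∈ W, S₂ *ᵥ w = 0) ∧ (∀ w ∈ W, S₄ *ᵥ w = 0) ∧
      fromBlocks G B C D = lower S₄ * upper S₃ * lower S₂ * upper S₁ := by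
  obtain ⟨Z, S, hZ, hZG, hS, hZW, hSZ⟩ := exists_isSymm_mul_eq_sub_one hG hGW
  have hY : (C * G⁻¹ - Z).IsSymm :=
    (isSymm_mul_inv_of_transpose_mul_eq (SymplecticGroup.fromBlocks_mem_iff.1 hH).1 hG).sub hZ
  have hGW' (w) (hw : w ∈ W) : G⁻¹ *ᵥ w = w := by
    nth_rw 1 [← hGW w hw]
    rw [mulVec_mulVec, nonsing_inv_mul _ hG, one_mulVec]
  have hcol (x : Fin d → K) : fromBlocks G B C D *ᵥ Sum.elim x 0 =
      (lower (C * G⁻¹ - Z) * upper S * lower (Z * G)) *ᵥ Sum.elim x 0 := by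
    have hGx : x + S *ᵥ (Z * G) *ᵥ x = G *ᵥ x := by
      rw [mulVec_mulVec, hSZ, sub_mulVec, one_mulVec, add_sub_cancel]
    have hCx : (C * G⁻¹ - Z) *ᵥ G *ᵥ x + (Z * G) *ᵥ x = C *ᵥ x := by
      rw [mulVec_mulVec, ← add_mulVec, sub_mul, nonsing_inv_mul_cancel_right _ _ hG,
        sub_add_cancel]
    rw [← mulVec_mulVec, ← mulVec_mulVec, lower_mulVec, add_zero, upper_mulVec, hGx,
      lower_mulVec, hCx, fromBlocks_mulVec_elim_zero]
  obtain ⟨S₁, hS₁, h⟩ := exists_eq_mul_upper_of_mulVec_eq hH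
    (mul_mem (mul_mem (lower_mem_symplecticGroup hY) (upper_mem_symplecticGroup hS))
      (lower_mem_symplecticGroup hZG)) hcol
  refine ⟨S₁, Z * G, S, C * G⁻¹ - Z, hS₁, hZG, hS, hY, fun w hw => ?_, fun w hw => ?_, h⟩
  · rw [← mulVec_mulVec, hGW w hw, hZW w hw]
  · rw [sub_mulVec, ← mulVec_mulVec, hGW' w hw, hCW w hw, hZW w hw, sub_zero]

theorem exists_eq_upper_mul_lower_mul_upper_mul_lower_mul_upper
    {H : Matrix (Fin d ⊕ Fin d) (Fin d ⊕ Fin d) K} (hH : H ∈ symplecticGroup (Fin d) K)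
    {W : Submodule K (Fin d → K)} (hW : ∀ w ∈ W, H *ᵥ Sum.elim w 0 = Sum.elim w 0) :
    ∃ S₁ S₂ S₃ S₄ S₅ : Matrix (Fin d) (Fin d) K,
      S₁.IsSymm ∧ S₂.IsSymm ∧ S₃.IsSymm ∧ S₄.IsSymm ∧ S₅.IsSymm ∧
      (∀ w ∈ W, S₂ *ᵥ w = 0) ∧ (∀ w ∈ W, S₄ *ᵥ w = 0) ∧
      H = upper S₅ * lower S₄ * upper S₃ * lower S₂ * upper S₁ := by
  obtain ⟨A, B, C, D, rfl⟩ : ∃ A B C D, H = fromBlocks A B C D :=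
    ⟨_, _, _, _, (fromBlocks_toBlocks H).symm⟩
  have hACW (w) (hw : w ∈ W) : A *ᵥ w = w ∧ C *ᵥ w = 0 := by
    rw [← Sum.elim_eq_iff, ← fromBlocks_mulVec_elim_zero A B C D, hW w hw]
  obtain ⟨X, hX, hdet⟩ := exists_isSymm_isUnit_det_add_mul_of_mem_symplecticGroup hH
  have hXH : upper X * fromBlocks A B C D = fromBlocks (A + X * C) (B + X * D) C D := by
    simp [upper, fromBlocks_multiply]
  obtain ⟨S₁, S₂, S₃, S₄, h₁, h₂, h₃, h₄, hS₂, hS₄, h⟩ :=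
    exists_eq_lower_mul_upper_mul_lower_mul_upper (W := W)
      (hXH ▸ mul_mem (upper_mem_symplecticGroup hX) hH) hdet
      (fun w hw => by
        rw [add_mulVec, ← mulVec_mulVec, (hACW w hw).1, (hACW w hw).2, mulVec_zero, add_zero])
      fun w hw => (hACW w hw).2
  refine ⟨S₁, S₂, S₃, S₄, -X, h₁, h₂, h₃, h₄, hX.neg, hS₂, hS₄, ?_⟩
  calc fromBlocks A B C D = upper (-X) * (upper X * fromBlocks A B C D) := by
        rw [← mul_assoc, upper_mul_upper, neg_add_cancel, upper_zero, one_mul]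
    _ = upper (-X) * lower S₄ * upper S₃ * lower S₂ * upper S₁ := by
        simp only [hXH, h, mul_assoc]

theorem mem_unitTriangularProducts_five {Q : Matrix (Fin d ⊕ Fin d) (Fin d ⊕ Fin d) K}
    (hQ : Q ∈ symplecticGroup (Fin d) K) : Q ∈ unitTriangularProducts d K 5 := by
  obtain ⟨S₁, S₂, S₃, S₄, S₅, h₁, h₂, h₃, h₄, h₅, -, -, h⟩ :=
    exists_eq_upper_mul_lower_mul_upper_mul_lower_mul_upper hQ (W := ⊥) (by simp)
  refine ⟨[upper S₅, lower S₄, upper S₃, lower S₂, upper S₁], rfl, ?_, by simp [h, mul_assoc]⟩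
  simp only [List.forall_mem_cons, List.not_mem_nil, false_imp_iff, implies_true, and_true]
  exact ⟨⟨_, h₅, .inl rfl⟩, ⟨_, h₄, .inr rfl⟩, ⟨_, h₃, .inl rfl⟩, ⟨_, h₂, .inr rfl⟩,
    ⟨_, h₁, .inl rfl⟩⟩

theorem exists_eq_lower_mul_upper_mul_lower_mul_upper_mul_lower_mul_upper_iff {p : Fin d → K}
    {F : Matrix (Fin d ⊕ Fin d) (Fin d ⊕ Fin d) K} :
    (∃ S₁ S₂ S₃ S₄ S₅ S₆ : Matrix (Fin d) (Fin d) K,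
      S₁.IsSymm ∧ S₃.IsSymm ∧ S₅.IsSymm ∧ (S₂.IsSymm ∧ S₂ *ᵥ p = 0) ∧
      (S₄.IsSymm ∧ S₄ *ᵥ p = 0) ∧ (S₆.IsSymm ∧ S₆ *ᵥ p = 0) ∧
      F = lower S₆ * upper S₅ * lower S₄ * upper S₃ * lower S₂ * upper S₁) ↔
    F ∈ symplecticGroup (Fin d) K ∧ F *ᵥ Sum.elim p 0 = Sum.elim p 0 := by
  constructor
  · rintro ⟨S₁, S₂, S₃, S₄, S₅, S₆, h₁, h₃, h₅, ⟨h₂, hp₂⟩, ⟨h₄, hp₄⟩, ⟨h₆, hp₆⟩, rfl⟩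
    refine ⟨?_, ?_⟩
    · exact mul_mem (mul_mem (mul_mem (mul_mem (mul_mem
        (lower_mem_symplecticGroup h₆) (upper_mem_symplecticGroup h₅))
        (lower_mem_symplecticGroup h₄)) (upper_mem_symplecticGroup h₃))
        (lower_mem_symplecticGroup h₂)) (upper_mem_symplecticGroup h₁)
    · simp only [← mulVec_mulVec, upper_mulVec, lower_mulVec, mulVec_zero, add_zero, *]
  · rintro ⟨hF, hFp⟩
    obtain ⟨S₁, S₂, S₃, S₄, S₅, h₁, h₂, h₃, h₄, h₅, hp₂, hp₄, h⟩ :=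
      exists_eq_upper_mul_lower_mul_upper_mul_lower_mul_upper hF (W := K ∙ p) fun w hw => by
        obtain ⟨c, rfl⟩ := Submodule.mem_span_singleton.1 hw
        have hc : Sum.elim (c • p) (0 : Fin d → K) = c • Sum.elim p 0 := by
          ext (i | i) <;> simp
        rw [hc, mulVec_smul, hFp]
    have hp := Submodule.mem_span_singleton_self (R := K) p
    exact ⟨S₁, S₂, S₃, S₄, S₅, 0, h₁, h₃, h₅, ⟨h₂, hp₂ p hp⟩, ⟨h₄, hp₄ p hp⟩,
      ⟨isSymm_zero, zero_mulVec p⟩, by rw [lower_zero, one_mul, h]⟩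

theorem mem_singularSymplectic_iff {H : Matrix (Fin d ⊕ Fin d) (Fin d ⊕ Fin d) K} :
    H ∈ singularSymplectic d K ↔ H ∈ symplecticGroup (Fin d) K ∧ ∃ v ≠ 0, H *ᵥ v = v := by
  simp only [singularSymplectic, Set.mem_ofPred_eq, ← exists_mulVec_eq_zero_iff, sub_mulVec,
    one_mulVec, sub_eq_zero]

theorem mem_singularSymplectic_iff_exists_conj {e : Fin d ⊕ Fin d → K} (he : e ≠ 0)
    {H : Matrix (Fin d ⊕ Fin d) (Fin d ⊕ Fin d) K} :
    H ∈ singularSymplectic d K ↔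
      ∃ Q ∈ symplecticGroup (Fin d) K, ∃ F,
        (F ∈ symplecticGroup (Fin d) K ∧ F *ᵥ e = e) ∧ H = Q * F * Q⁻¹ := by
  rw [mem_singularSymplectic_iff]
  constructor
  · rintro ⟨hH, v, hv, hHv⟩
    obtain ⟨Q, hQ, rfl⟩ := exists_symplectic_mulVec_eq he hv
    have hdet := SymplecticGroup.symplectic_det hQ
    refine ⟨Q, hQ, Q⁻¹ * H * Q, ⟨mul_mem (mul_mem (inv_mem_symplecticGroup hQ) hH) hQ, ?_⟩, ?_⟩
    · rw [← mulVec_mulVec, ← mulVec_mulVec, hHv, mulVec_mulVec, nonsing_inv_mul _ hdet,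
        one_mulVec]
    · rw [mul_assoc, mul_nonsing_inv_cancel_right _ _ hdet, mul_nonsing_inv_cancel_left _ _ hdet]
  · rintro ⟨Q, hQ, F, ⟨hF, hFe⟩, rfl⟩
    have hdet := SymplecticGroup.symplectic_det hQ
    have hinj := mulVec_injective_of_isUnit ((isUnit_iff_isUnit_det Q).2 hdet)
    refine ⟨mul_mem (mul_mem hQ hF) (inv_mem_symplecticGroup hQ), Q *ᵥ e, fun h => he ?_, ?_⟩
    · exact hinj (h.trans (mulVec_zero Q).symm)
    · rw [mulVec_mulVec, nonsing_inv_mul_cancel_right _ _ hdet, ← mulVec_mulVec, hFe]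

end Field

end Symplectic

section PadZero

variable {K : Type*} [CommRing K] {n : ℕ}

theorem padZero_zero_left (T : Matrix (Fin n) (Fin n) K) (j : Fin (n + 1)) :
    padZero T (0 : Fin (n + 1)) j = 0 := by
  simp [padZero]

theorem padZero_zero_right (T : Matrix (Fin n) (Fin n) K) (i : Fin (n + 1)) :
    padZero T i (0 : Fin (n + 1)) = 0 := by
  simp [padZero]

theorem padZero_succ_succ (T : Matrix (Fin n) (Fin n) K) (i j : Fin n) :
    padZero T i.succ j.succ = T i j := by
  simp [padZero]

theorem exists_padZero_eq_iff {S : Matrix (Fin (n + 1)) (Fin (n + 1)) K} :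
    (∃ T : Matrix (Fin n) (Fin n) K, T.IsSymm ∧ padZero T = S) ↔
      S.IsSymm ∧ S *ᵥ Pi.single 0 1 = 0 := by
  rw [mulVec_single_one]
  constructor
  · rintro ⟨T, hT, rfl⟩
    refine ⟨IsSymm.ext fun i j => ?_, funext fun i => padZero_zero_right T i⟩
    cases i using Fin.cases <;> cases j using Fin.cases <;>
      simp only [padZero_zero_left, padZero_zero_right, padZero_succ_succ, hT.apply]
  · rintro ⟨hS, hS0⟩
    have hcol (i) : S i 0 = 0 := congrFun hS0 i
    have hrow (j) : S 0 j = 0 := (hS.apply 0 j).symm.trans (hcol j)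
    refine ⟨S.submatrix Fin.succ Fin.succ, hS.submatrix _, ?_⟩
    ext i j
    cases i using Fin.cases <;> cases j using Fin.cases <;>
      simp only [padZero_zero_left, padZero_zero_right, padZero_succ_succ, submatrix_apply,
        hcol, hrow]

end PadZero

end UnitTriangularSymplectic

open UnitTriangularSymplectic in
theorem mainTheorem7_general (K : Type*) [Field K] (d : ℕ) (hd : 1 ≤ d) :
    singularSymplectic d K =
      {H | ∃ (S₁ S₃ S₅ : Matrix (Fin d) (Fin d) K)
          (S₂ S₄ S₆ : Matrix (Fin (d - 1)) (Fin (d - 1)) K)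
          (Q : Matrix (Fin d ⊕ Fin d) (Fin d ⊕ Fin d) K),
          S₁.IsSymm ∧ S₃.IsSymm ∧ S₅.IsSymm ∧ S₂.IsSymm ∧ S₄.IsSymm ∧ S₆.IsSymm ∧
          Q ∈ Matrix.symplecticGroup (Fin d) K ∧
          H = Q *
            (lower (padZero S₆) * upper S₅ * lower (padZero S₄) * upper S₃ *
              lower (padZero S₂) * upper S₁) * Q⁻¹} ∧
    ∀ Q ∈ Matrix.symplecticGroup (Fin d) K, Q ∈ unitTriangularProducts d K 5 := by
  refine ⟨?_, fun Q => mem_unitTriangularProducts_five⟩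
  obtain ⟨n, rfl⟩ := Nat.exists_eq_add_of_le' hd
  have he : (Sum.elim (Pi.single 0 1) 0 : Fin (n + 1) ⊕ Fin (n + 1) → K) ≠ 0 :=
    Function.ne_iff.2 ⟨Sum.inl 0, by simp⟩
  ext H
  simp only [mem_singularSymplectic_iff_exists_conj he, Set.mem_ofPred_eq,
    ← exists_eq_lower_mul_upper_mul_lower_mul_upper_mul_lower_mul_upper_iff,
    ← exists_padZero_eq_iff]
  constructor
  · rintro ⟨Q, hQ, _, ⟨S₁, _, S₃, _, S₅, _, h₁, h₃, h₅, ⟨S₂, h₂, rfl⟩, ⟨S₄, h₄, rfl⟩,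
      ⟨S₆, h₆, rfl⟩, rfl⟩, rfl⟩
    exact ⟨S₁, S₃, S₅, S₂, S₄, S₆, Q, h₁, h₃, h₅, h₂, h₄, h₆, hQ, rfl⟩
  · rintro ⟨S₁, S₃, S₅, S₂, S₄, S₆, Q, h₁, h₃, h₅, h₂, h₄, h₆, hQ, rfl⟩
    exact ⟨Q, hQ, _, ⟨S₁, _, S₃, _, S₅, _, h₁, h₃, h₅, ⟨S₂, h₂, rfl⟩, ⟨S₄, h₄, rfl⟩,
      ⟨S₆, h₆, rfl⟩, rfl⟩, rfl⟩

theorem mainTheorem7 (K : Type*) [RCLike K] (d : ℕ) (hd : 1 ≤ d) :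
    UnitTriangularSymplectic.singularSymplectic d K =
      {H | ∃ (S₁ S₃ S₅ : Matrix (Fin d) (Fin d) K)
          (S₂ S₄ S₆ : Matrix (Fin (d - 1)) (Fin (d - 1)) K)
          (Q : Matrix (Fin d ⊕ Fin d) (Fin d ⊕ Fin d) K),
          S₁.IsSymm ∧ S₃.IsSymm ∧ S₅.IsSymm ∧ S₂.IsSymm ∧ S₄.IsSymm ∧ S₆.IsSymm ∧
          Q ∈ Matrix.symplecticGroup (Fin d) K ∧
          H = Q *
            (UnitTriangularSymplectic.lower (UnitTriangularSymplectic.padZero S₆) *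
              UnitTriangularSymplectic.upper S₅ *
              UnitTriangularSymplectic.lower (UnitTriangularSymplectic.padZero S₄) *
              UnitTriangularSymplectic.upper S₃ *
              UnitTriangularSymplectic.lower (UnitTriangularSymplectic.padZero S₂) *
              UnitTriangularSymplectic.upper S₁) * Q⁻¹} ∧
    ∀ Q ∈ Matrix.symplecticGroup (Fin d) K,
      Q ∈ UnitTriangularSymplectic.unitTriangularProducts d K 5 :=
  mainTheorem7_general K d hd
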